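/- Let $G$ be a group. A series of normal subgroups of $G$ $$G = G_1 > G_2 > \dots > G_n > G_{n+1} = 1$$ (strict inclusions) is called principal if every factor $G_i/G_{i+1}$ ($1\le i\le n$) is abelian and has no torsion as a right $\mathbb{Z}[G/G_i]$-module under the action of $G$ by conjugation, i.e. for $x \in G_i/G_{i+1}$ and $u \in \mathbb{Z}[G/G_i]$, $x^u = 1$ implies $u = 0$ or $x = 1$. A group with a principal series is called rigid (the trivial group is rigid, with the series of length $n=0$). A rigid group that is solvable of class exactly $n$ is called $n$-rigid. Let $A_m$ be the free abelian group of rank $m$ (with $m \ge 0$), let $A\wr B$ denote the restricted wreath product (with base group the functions $B\to A$ of finite support), and put $W(m,0)=A_m$ and $W(m,n)=A_m\wr W(m,n-1)$ for $n\ge 1$. **Proposition.** (1) Every $n$-rigid group generated by $m$ elements embeds into $W(m,n)$; moreover, if $n\ge 1$, it embeds already into $W(m,n-1)$, the iterated wreath product of $n$ copies of $A_m$. (2) Conversely, for all $m,n \ge 0$ the group $W(m,n)$ is rigid, and every finitely generated subgroup of $W(m,n)$ is rigid. -/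

import Mathlib

/-! ### Rigid groups -/

section Rigid

variable {G : Type*} [Group G]

/-- For normal subgroups `H`, `K` of `G`, the group `G` acts on the factor `H / (H ∩ K)` by
conjugation: `g` sends the class of `a` to the class of `g a g⁻¹`. -/
def factorConj (H K : Subgroup G) [H.Normal] [K.Normal] :
    G →* MulAut (H ⧸ K.subgroupOf H) where
  toFun g := QuotientGroup.congr (K.subgroupOf H) (K.subgroupOf H) (MulAut.conjNormal g) (by
    ext a
    constructor
    · rintro ⟨b, hb, rfl⟩
      have h := ‹K.Normal›.conj_mem _ (Subgroup.mem_subgroupOf.1 hb) g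
      simpa [Subgroup.mem_subgroupOf] using h
    · intro ha
      refine ⟨(MulAut.conjNormal g).symm a, ?_, by simp⟩
      have h := ‹K.Normal›.conj_mem _ (Subgroup.mem_subgroupOf.1 ha) g⁻¹
      simpa [Subgroup.mem_subgroupOf] using h)
  map_one' := by
    ext x
    induction x using QuotientGroup.induction_on with
    | H a => simp
  map_mul' g h := by
    ext x
    induction x using QuotientGroup.induction_on with
    | H a => simp

/-- If the factor `H / (H ∩ K)` is abelian, then `H` acts trivially on it, and the conjugation
action of `G` descends to an action of `G / H`. -/
def factorConjQuot (H K : Subgroup G) [H.Normal] [K.Normal]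
    (hab : ∀ a b : H ⧸ K.subgroupOf H, a * b = b * a) :
    G ⧸ H →* MulAut (H ⧸ K.subgroupOf H) :=
  QuotientGroup.lift H (factorConj H K) (by
    intro g hg
    ext x
    induction x using QuotientGroup.induction_on with
    | H a =>
      have e : (MulAut.conjNormal g : MulAut H) a = ⟨g, hg⟩ * a * ⟨g, hg⟩⁻¹ := by
        ext
        simp
      have h : ((⟨g, hg⟩ * a * ⟨g, hg⟩⁻¹ : H) : H ⧸ K.subgroupOf H) = a := by
        rw [QuotientGroup.mk_mul, QuotientGroup.mk_mul, QuotientGroup.mk_inv, hab,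
          inv_mul_cancel_left]
      simpa [factorConj, e] using h)

/-- The right action of the group ring `ℤ[G / H]` on the abelian factor `H / (H ∩ K)`, written
exponentially: for `u = m₁ h̄₁ + ⋯ + m_k h̄_k` it is `x ^ u = (x ^ h₁) ^ m₁ ⋯ (x ^ h_k) ^ m_k`,
where `x ^ h` is the class of `h⁻¹ a h` if `x` is the class of `a`. -/
noncomputable def factorPow (H K : Subgroup G) [H.Normal] [K.Normal]
    (hab : ∀ a b : H ⧸ K.subgroupOf H, a * b = b * a)
    (x : H ⧸ K.subgroupOf H) (u : MonoidAlgebra ℤ (G ⧸ H)) : H ⧸ K.subgroupOf H :=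
  letI : CommGroup (H ⧸ K.subgroupOf H) := { (inferInstance : Group _) with mul_comm := hab }
  u.coeff.prod fun h m => (factorConjQuot H K hab h⁻¹ x) ^ m

/-- The factor `H / K` (for normal subgroups `K ≤ H` of `G`) is abelian and has no torsion as a
right `ℤ[G / H]`-module: `x ^ u = 1` only if `u = 0` or `x = 1`. -/
structure IsTorsionFreeFactor (H K : Subgroup G) [H.Normal] [K.Normal] : Prop where
  comm : ∀ a b : H ⧸ K.subgroupOf H, a * b = b * a
  no_torsion : ∀ (x : H ⧸ K.subgroupOf H) (u : MonoidAlgebra ℤ (G ⧸ H)),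
    factorPow H K comm x u = 1 → u = 0 ∨ x = 1

/-- `S 0 > S 1 > ⋯ > S n` is a principal series of length `n` of `G`: a strictly descending series
of normal subgroups of `G` from `G` to `1` whose factors `S i / S (i + 1)` are abelian and have no
torsion as `ℤ[G / S i]`-modules. (The trivial group has the series of length `0`.) -/
structure IsPrincipalSeries {n : ℕ} (S : Fin (n + 1) → Subgroup G) : Prop where
  normal : ∀ i, (S i).Normal
  zero_eq_top : S 0 = ⊤
  last_eq_bot : S (Fin.last n) = ⊥
  succ_lt : ∀ i : Fin n, S i.succ < S i.castSucc
  factor : ∀ i : Fin n, haveI := normal i.castSucc; haveI := normal i.succ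
    IsTorsionFreeFactor (S i.castSucc) (S i.succ)

variable (G)

/-- A group is rigid if it has a principal series. -/
def IsRigid : Prop :=
  ∃ (n : ℕ) (S : Fin (n + 1) → Subgroup G), IsPrincipalSeries S

/-- `G` is solvable of class exactly `c`. -/
def IsSolvableOfClass (c : ℕ) : Prop :=
  derivedSeries G c = ⊥ ∧ ∀ k < c, derivedSeries G k ≠ ⊥

/-- An `n`-rigid group is a rigid group that is solvable of class exactly `n`. -/
def IsNRigid (n : ℕ) : Prop :=
  IsRigid G ∧ IsSolvableOfClass G n

/-- `G` is generated by `m` (not necessarily distinct) elements. -/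
def IsGeneratedBy (m : ℕ) : Prop :=
  ∃ g : Fin m → G, Subgroup.closure (Set.range g) = ⊤

end Rigid

/-! ### Iterated wreath products -/

section Wreath

/-- The restricted (discrete) wreath product `A ≀ B`: the subgroup of the unrestricted regular
wreath product `A ≀ᵣ B`, with base group `B → A`, formed by the pairs `(f, b)` for which `f` has
finite support. -/
def restrictedWreath (A B : Type*) [Group A] [Group B] : Subgroup (A ≀ᵣ B) where
  carrier := {w | (Function.mulSupport w.left).Finite}
  one_mem' := by simp
  mul_mem' {v w} hv hw := by
    simp only [Set.mem_ofPred_eq, RegularWreathProduct.mul_left] at *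
    refine (hv.union (hw.preimage (f := fun x => v.right⁻¹ * x)
      (mul_right_injective _).injOn)).subset ?_
    exact Function.mulSupport_mul _ _
  inv_mem' {w} hw := by
    simp only [Set.mem_ofPred_eq, RegularWreathProduct.inv_left] at *
    refine (hw.preimage (f := fun x => w.right * x) (mul_right_injective _).injOn).subset ?_
    intro x hx
    simpa using hx

/-- The free abelian group `A_m = ℤ^m` of rank `m`, written multiplicatively. -/
abbrev FreeAb (m : ℕ) : Type := Multiplicative (Fin m → ℤ)

/-- The iterated wreath products `W(m,0) = A_m` and `W(m,n+1) = A_m ≀ W(m,n)`. -/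
def iteratedWreath (m : ℕ) : ℕ → GrpCat.{0}
  | 0 => GrpCat.of (FreeAb m)
  | n + 1 => GrpCat.of (restrictedWreath (FreeAb m) (iteratedWreath m n))

end Wreath

/-!
Subgroups of `W(m, n)` are rigid because the base group of `A_m ≀ C` is a free module over `ℤ[C]`.
The group `W(m, n)` has unique products, being built from free abelian groups by extensions
(`UniqueProds.of_ker`), so `ℤ[W(m, n)]` has no zero divisors and the kernels of the projections
`W(m, n) → W(m, n - 1) → ⋯`, intersected with any subgroup, have torsion-free factors
(`hasTorsionFreeFactor_of_restrictedWreath`). Finite generation plays no role here.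

For the embedding, let `G` be `m`-generated and let `H > K` be consecutive terms of a principal
series, so that `A = H / K` is a torsion-free module over `R = ℤ[G / H]`. Given an embedding of
`G / H` into an iterated wreath product `C`, one of `G / K` into `A_m ≀ C` amounts to a derivation
`G → R ^ m` whose restriction to `H` has kernel `K`
(`exists_derivation_of_isTorsionFreeFactor`). The Kaloujnine–Krasner construction gives a derivation
of `G` into the functions from `G / H` to `A` which restricts to an `R`-linear embedding of `A`. Its
values span an `R`-module `M` with `m` generators. The ring `R` is a domain, as `C` has unique
products, and it satisfies both Ore conditions, as `G / H` is solvable: solvable groups have Følner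
sets (`isFolner_of_isSolvable`), and then a nontrivial common multiple of two elements exists for
reasons of rank (`IsFolner.exists_mul_eq_mul`). Hence `M` modulo its torsion spans a space of
dimension at most `m` over the division ring of fractions of `R`, and clearing denominators maps `M`
to `R ^ m` with only torsion in the kernel (`exists_linearMap_span_pi_ker_torsion`). The module `A`
is torsion-free and meets this kernel trivially, so it survives.

The number of wreath factors obtained is the length of the principal series. It is at most the
solvability class (`IsPrincipalSeries.length_le`): for `x` outside `H` and `y` in `H` outside `K`,
the commutator of `x` and `y` is the value at `y` of a nonzero element of `R` and lies outside `K`,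
so double commutators produce elements of each derived subgroup outside the next term of the series.
-/

/-! ### Følner sets in solvable groups -/

section Folner

open scoped Pointwise

/-- The (right) Følner condition in multiplicative form: for every finite set `S` there are finite
nonempty sets `F` which grow by a factor arbitrarily close to `1` when multiplied by `S`. The
choice of a decision procedure for equality matters only for the formation of `F * S`. -/
def IsFolner (G : Type*) [Group G] : Prop :=
  ∀ (_ : DecidableEq G) (S : Finset G) (c : ℝ), 1 < c →
    ∃ F : Finset G, F.Nonempty ∧ ((F * S).card : ℝ) ≤ c * F.card

theorem exists_prod_pow_eq_of_mem_pow {G : Type*} [CommGroup G] [DecidableEq G] (S : Finset G)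
    (n : ℕ) {x : G} (hx : x ∈ S ^ n) :
    ∃ a : S → ℕ, (∀ s, a s ≤ n) ∧ ∏ s : S, (s : G) ^ a s = x := by
  induction n generalizing x with
  | zero => exact ⟨0, by simp, by rw [pow_zero, Finset.mem_one] at hx; simp [hx]⟩
  | succ n ih =>
    rw [pow_succ, Finset.mem_mul] at hx
    obtain ⟨y, hy, z, hz, rfl⟩ := hx
    obtain ⟨a, ha, rfl⟩ := ih hy
    refine ⟨a + Pi.single ⟨z, hz⟩ 1, fun s => ?_, ?_⟩
    · have h1 : (Pi.single (⟨z, hz⟩ : S) 1 : S → ℕ) s ≤ 1 := by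
        rw [Pi.single_apply]
        split_ifs <;> simp
      exact Nat.add_le_add (ha s) h1
    · simp only [Pi.add_apply, pow_add, Finset.prod_mul_distrib]
      congr 1
      rw [Finset.prod_eq_single (⟨z, hz⟩ : S)]
      · simp
      · intro b _ hb
        simp [hb]
      · simp

/-- Abelian groups have polynomial growth. -/
theorem card_pow_le_of_commGroup {G : Type*} [CommGroup G] [DecidableEq G] (S : Finset G) (n : ℕ) :
    (S ^ n).card ≤ (n + 1) ^ S.card := by
  have h : S ^ n ⊆ (Fintype.piFinset fun _ : S => Finset.range (n + 1)).image
      fun a => ∏ s : S, (s : G) ^ a s := by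
    intro x hx
    obtain ⟨a, ha, rfl⟩ := exists_prod_pow_eq_of_mem_pow S n hx
    exact Finset.mem_image_of_mem _
      (Fintype.mem_piFinset.2 fun s => Finset.mem_range.2 (Nat.lt_succ_of_le (ha s)))
  calc (S ^ n).card ≤ _ := Finset.card_le_card h
    _ ≤ _ := Finset.card_image_le
    _ = _ := by simp [Fintype.card_piFinset]

/-- In an abelian group some power `S ^ n` is a Følner set, as otherwise `S ^ n` would grow
exponentially. -/
theorem isFolner_of_commGroup (G : Type*) [CommGroup G] : IsFolner G := by
  intro _ S c hc
  rcases S.eq_empty_or_nonempty with rfl | hS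
  · refine ⟨{1}, by simp, ?_⟩
    simp
    linarith
  by_contra! hcon
  -- without Følner sets each multiplication by `S` enlarges `S ^ n` by a factor of at least `c`
  have hgrow : ∀ n : ℕ, c ^ n ≤ ((S ^ n).card : ℝ) := by
    intro n
    induction n with
    | zero => simp
    | succ n ih =>
      rw [pow_succ c, pow_succ S, mul_comm]
      exact (mul_le_mul_of_nonneg_left ih (by linarith)).trans (hcon (S ^ n) (hS.pow)).le
  have hlim := (tendsto_pow_const_div_const_pow_of_one_lt S.card hc).comp
    (Filter.tendsto_add_atTop_nat 1)
  have hlt : (0 : ℝ) < c⁻¹ := by positivity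
  obtain ⟨n, hn⟩ := (hlim.eventually (gt_mem_nhds hlt)).exists
  have h1 : c ^ n ≤ ((n + 1 : ℕ) : ℝ) ^ S.card :=
    (hgrow n).trans (by exact_mod_cast card_pow_le_of_commGroup S n)
  have hcp : (0 : ℝ) < c ^ (n + 1) := by positivity
  simp only [Function.comp_apply] at hn
  rw [div_lt_iff₀ hcp, pow_succ', inv_mul_cancel_left₀ (by positivity)] at hn
  linarith

/-- Lift a Følner set of the quotient by a section `σ` and multiply it by a Følner set of the
subgroup, chosen for the finitely many errors `σ q * s * (σ (q * s))⁻¹`. -/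
theorem IsFolner.of_quotient {G : Type*} [Group G] (N : Subgroup G) [N.Normal]
    (hN : IsFolner N) (hQ : IsFolner (G ⧸ N)) : IsFolner G := by
  intro _ S c hc
  classical
  have hc' : 1 < √c := by
    rw [Real.lt_sqrt] <;> linarith
  obtain ⟨P, hP, hPc⟩ := hQ inferInstance (S.image (QuotientGroup.mk' N)) _ hc'
  let σ : G ⧸ N → G := Quotient.out
  have hσ : ∀ q, (σ q : G ⧸ N) = q := fun q => Quotient.out_eq' q
  have hmem : ∀ (q : G ⧸ N) (s : G), σ q * s * (σ (q * s))⁻¹ ∈ N := by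
    intro q s
    rw [← QuotientGroup.eq_one_iff]
    simp [hσ]
  let e : G ⧸ N → G → N := fun q s => ⟨_, hmem q s⟩
  obtain ⟨F, hF, hFc⟩ := hN inferInstance (Finset.image₂ e P S) _ hc'
  have hinj : Function.Injective2 (fun (n : N) (q : G ⧸ N) => (n : G) * σ q) := by
    intro n n' q q' h
    have hq : q = q' := by
      have := congrArg (QuotientGroup.mk' N) h
      simpa [hσ, (QuotientGroup.eq_one_iff _).2 n.2, (QuotientGroup.eq_one_iff _).2 n'.2] using this
    subst hq
    exact ⟨Subtype.ext (mul_right_cancel h), rfl⟩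
  refine ⟨Finset.image₂ (fun (n : N) (q : G ⧸ N) => (n : G) * σ q) F P, hF.image₂ hP, ?_⟩
  have hsub : Finset.image₂ (fun (n : N) (q : G ⧸ N) => (n : G) * σ q) F P * S ⊆
      Finset.image₂ (fun (n : N) (q : G ⧸ N) => (n : G) * σ q) (F * Finset.image₂ e P S)
        (P * S.image (QuotientGroup.mk' N)) := by
    intro x hx
    obtain ⟨y, hy, s, hs, rfl⟩ := Finset.mem_mul.1 hx
    obtain ⟨n, hn, q, hq, rfl⟩ := Finset.mem_image₂.1 hy
    refine Finset.mem_image₂.2 ⟨n * e q s, Finset.mul_mem_mul hn (Finset.mem_image₂_of_mem hq hs),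
      q * s, Finset.mul_mem_mul hq (Finset.mem_image_of_mem _ hs), ?_⟩
    simp [e, mul_assoc]
  rw [Finset.card_image₂ hinj]
  have h2 : ((Finset.image₂ (fun (n : N) (q : G ⧸ N) => (n : G) * σ q) F P * S).card : ℝ) ≤
      ((F * Finset.image₂ e P S).card : ℝ) * (P * S.image (QuotientGroup.mk' N)).card := by
    exact_mod_cast (Finset.card_le_card hsub).trans (Finset.card_image₂_le _ _ _)
  refine h2.trans ((mul_le_mul hFc hPc (by positivity) (by positivity)).trans (le_of_eq ?_))
  have hs : √c * √c = c := Real.mul_self_sqrt (by linarith)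
  push_cast
  linear_combination (F.card * P.card : ℝ) * hs

theorem isFolner_of_derivedSeries_eq_bot (n : ℕ) :
    ∀ (G : Type*) [Group G], derivedSeries G n = ⊥ → IsFolner G := by
  induction n with
  | zero =>
    intro G _ h
    have : Subsingleton G := by
      rw [← Subgroup.subsingleton_iff]
      exact subsingleton_of_bot_eq_top (by simpa using h.symm)
    let _ : CommGroup G :=
      { (inferInstance : Group G) with mul_comm := fun _ _ => Subsingleton.elim _ _ }
    exact isFolner_of_commGroup G
  | succ n ih =>
    intro G _ h
    refine IsFolner.of_quotient (derivedSeries G n) ?_ (ih _ ?_)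
    · let _ : CommGroup (derivedSeries G n) :=
        { (inferInstance : Group (derivedSeries G n)) with
          mul_comm := fun a b => by
            have hab := Subgroup.commutator_mem_commutator a.2 b.2
            rw [← derivedSeries_succ, h, Subgroup.mem_bot, commutatorElement_eq_one_iff_mul_comm]
              at hab
            exact Subtype.ext hab }
      exact isFolner_of_commGroup _
    · rw [← map_derivedSeries_eq (QuotientGroup.mk'_surjective (derivedSeries G n)),
        Subgroup.map_eq_bot_iff, QuotientGroup.ker_mk']

theorem isFolner_of_isSolvable (G : Type*) [Group G] [hG : Group.IsSolvable G] : IsFolner G := by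
  obtain ⟨n, hn⟩ := hG.solvable
  exact isFolner_of_derivedSeries_eq_bot n G hn

end Folner

/-! ### The Ore condition for group rings of solvable groups -/

section Ore

open scoped Pointwise

variable {B : Type*} [Group B]

/-- If two additive maps send the group elements of `F` to combinations of fewer than `2 |F|` group
elements, then their images on the span of `F` have a nontrivial relation, by comparing ranks. -/
theorem MonoidAlgebra.exists_eq_of_card_lt (f g : MonoidAlgebra ℤ B →ₗ[ℤ] MonoidAlgebra ℤ B)
    (F T : Finset B) (hf : ∀ x ∈ F, (f (single x 1)).coeff.support ⊆ T)
    (hg : ∀ x ∈ F, (g (single x 1)).coeff.support ⊆ T) (hT : T.card < 2 * F.card) :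
    ∃ u v, (u ≠ 0 ∨ v ≠ 0) ∧ f u = g v := by
  classical
  let w : F ⊕ F → MonoidAlgebra ℤ B :=
    Sum.elim (fun x => f (single (x : B) 1)) (fun x => -g (single (x : B) 1))
  have hw : ∀ i, ∀ y, y ∉ T → (w i).coeff y = 0 := by
    rintro (x | x) y hy
    · exact Finsupp.notMem_support_iff.1 fun h => hy (hf x x.2 h)
    · have : (g (single (x : B) 1)).coeff y = 0 :=
        Finsupp.notMem_support_iff.1 fun h => hy (hg x x.2 h)
      simpa [w] using this
  have hdep : ¬ LinearIndependent ℤ (fun (i : F ⊕ F) (y : T) => (w i).coeff (y : B)) := by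
    intro h
    have := h.fintype_card_le_finrank
    simp at this
    omega
  obtain ⟨c, hc, i, hi⟩ := Fintype.not_linearIndependent_iff.1 hdep
  have hc' : ∑ i, c i • w i = 0 := by
    ext y
    by_cases hy : y ∈ T
    · have := congrFun hc ⟨y, hy⟩
      simpa only [coeff_sum, coeff_smul, Finsupp.finsetSum_apply, Finsupp.smul_apply, coeff_zero,
        Finsupp.zero_apply, Finset.sum_apply, Pi.smul_apply, Pi.zero_apply] using this
    · simp only [coeff_sum, coeff_smul, Finsupp.finsetSum_apply, Finsupp.smul_apply, coeff_zero,
        Finsupp.zero_apply]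
      exact Finset.sum_eq_zero fun i _ => by rw [hw i y hy, smul_zero]
  have key : ∀ (d : F → ℤ) (x : F), (∑ x : F, d x • single (x : B) (1 : ℤ)).coeff x = d x := by
    intro d x
    rw [coeff_sum, Finsupp.finsetSum_apply, Finset.sum_eq_single x]
    · simp
    · intro y _ hy
      simp [Subtype.coe_injective.ne hy]
    · simp
  refine ⟨∑ x : F, c (Sum.inl x) • single (x : B) 1, ∑ x : F, c (Sum.inr x) • single (x : B) 1,
    ?_, ?_⟩
  · rcases i with x | x
    · exact Or.inl fun h => hi (by rw [← key (fun x => c (Sum.inl x)) x, h]; rfl)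
    · exact Or.inr fun h => hi (by rw [← key (fun x => c (Sum.inr x)) x, h]; rfl)
  · rw [Fintype.sum_sum_type] at hc'
    simp only [w, Sum.elim_inl, Sum.elim_inr, smul_neg, Finset.sum_neg_distrib] at hc'
    simpa only [map_sum, map_smul] using add_neg_eq_zero.1 hc'

theorem IsFolner.exists_card_mul_lt [DecidableEq B] (hB : IsFolner B) (S : Finset B) :
    ∃ F : Finset B, (F * S).card < 2 * F.card := by
  obtain ⟨F, hF, h⟩ := hB inferInstance S (3 / 2) (by norm_num)
  have : (0 : ℝ) < F.card := by exact_mod_cast hF.card_pos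
  exact ⟨F, by exact_mod_cast (by linarith : ((F * S).card : ℝ) < 2 * F.card)⟩

variable [NoZeroDivisors (MonoidAlgebra ℤ B)]

/-- The left Ore condition (Tamari): on the span of a Følner set `F` the multiplications by `a` and
by `b` take values in the span of a set smaller than `2 |F|`. -/
theorem IsFolner.exists_mul_eq_mul (hB : IsFolner B) (a : MonoidAlgebra ℤ B)
    {b : MonoidAlgebra ℤ B} (hb : b ≠ 0) : ∃ u v, u ≠ 0 ∧ u * a = v * b := by
  classical
  obtain ⟨F, hF⟩ := hB.exists_card_mul_lt (a.coeff.support ∪ b.coeff.support)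
  have hsupp : ∀ z : MonoidAlgebra ℤ B, z.coeff.support ⊆ a.coeff.support ∪ b.coeff.support →
      ∀ x ∈ F, (LinearMap.mulRight ℤ z (MonoidAlgebra.single x 1)).coeff.support ⊆
        F * (a.coeff.support ∪ b.coeff.support) := fun z hz x hx =>
    (MonoidAlgebra.support_coeff_mul_subset _ _).trans (Finset.mul_subset_mul
      (Finsupp.support_single_subset.trans (by simpa using hx)) hz)
  obtain ⟨u, v, huv, h⟩ := MonoidAlgebra.exists_eq_of_card_lt (LinearMap.mulRight ℤ a)
    (LinearMap.mulRight ℤ b) F _ (hsupp a Finset.subset_union_left)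
    (hsupp b Finset.subset_union_right) hF
  simp only [LinearMap.mulRight_apply] at h
  refine ⟨u, v, ?_, h⟩
  rintro rfl
  rw [zero_mul, eq_comm, mul_eq_zero] at h
  simp_all

/-- The right Ore condition, from inverses of Følner sets. -/
theorem IsFolner.exists_mul_eq_mul' (hB : IsFolner B) (a : MonoidAlgebra ℤ B)
    {b : MonoidAlgebra ℤ B} (hb : b ≠ 0) : ∃ u v, u ≠ 0 ∧ a * u = b * v := by
  classical
  obtain ⟨F, hF⟩ := hB.exists_card_mul_lt (a.coeff.support ∪ b.coeff.support)⁻¹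
  have hsupp : ∀ z : MonoidAlgebra ℤ B, z.coeff.support ⊆ a.coeff.support ∪ b.coeff.support →
      ∀ x ∈ F⁻¹, (LinearMap.mulLeft ℤ z (MonoidAlgebra.single x 1)).coeff.support ⊆
        (F * (a.coeff.support ∪ b.coeff.support)⁻¹)⁻¹ := fun z hz x hx => by
    rw [mul_inv_rev, inv_inv]
    exact (MonoidAlgebra.support_coeff_mul_subset _ _).trans (Finset.mul_subset_mul hz
      (Finsupp.support_single_subset.trans (by simpa using hx)))
  obtain ⟨u, v, huv, h⟩ := MonoidAlgebra.exists_eq_of_card_lt (LinearMap.mulLeft ℤ a)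
    (LinearMap.mulLeft ℤ b) F⁻¹ _ (hsupp a Finset.subset_union_left)
    (hsupp b Finset.subset_union_right) (by simpa only [Finset.card_inv] using hF)
  simp only [LinearMap.mulLeft_apply] at h
  refine ⟨u, v, ?_, h⟩
  rintro rfl
  rw [mul_zero, eq_comm, mul_eq_zero] at h
  simp_all

end Ore

/-! ### Torsion-free modules over Ore domains -/

section OreModule

open scoped nonZeroDivisors
open OreLocalization

variable {R : Type*} [Ring R] [IsDomain R] [OreSet R⁰]

/-- A finite family of elements of the division ring of left fractions of a domain with the right
Ore condition has a common right denominator. -/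
theorem OreLocalization.exists_common_right_denominator
    (hr : ∀ a b : R, b ≠ 0 → ∃ u v : R, u ≠ 0 ∧ a * u = b * v)
    {ι : Type*} (s : Finset ι) (q : ι → R[R⁰⁻¹]) :
    ∃ d : R, d ≠ 0 ∧ ∀ i ∈ s, ∃ p : R, q i * numeratorHom d = numeratorHom p := by
  classical
  induction s using Finset.induction_on with
  | empty => exact ⟨1, one_ne_zero, by simp⟩
  | insert i s _ ih =>
    obtain ⟨d, hd, h⟩ := ih
    have hone : ∀ x : R[R⁰⁻¹], ∃ e : R, e ≠ 0 ∧ ∃ p : R, x * numeratorHom e = numeratorHom p := by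
      intro x
      induction x using OreLocalization.ind with
      | _ r t =>
        obtain ⟨u, v, hu, huv⟩ := hr r t (nonZeroDivisors.ne_zero t.2)
        refine ⟨u, hu, v, ?_⟩
        rw [numeratorHom_apply, mul_div_one, huv, numeratorHom_apply]
        have := OreLocalization.expand' v (1 : R⁰) t
        rw [mul_one] at this
        exact this.symm
    obtain ⟨e, he, p, hp⟩ := hone (q i * numeratorHom d)
    refine ⟨d * e, mul_ne_zero hd he, fun j hj => ?_⟩
    rcases Finset.mem_insert.1 hj with rfl | hj
    · exact ⟨p, by rw [map_mul, ← mul_assoc, hp]⟩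
    · obtain ⟨p', hp'⟩ := h j hj
      exact ⟨p' * e, by rw [map_mul, ← mul_assoc, hp', map_mul]⟩

variable {M : Type*} [AddCommGroup M] [Module R M]

theorem OreLocalization.exists_smul_eq_zero_of_oreDiv_one_eq_zero {y : M}
    (h : y /ₒ (1 : R⁰) = 0) : ∃ s : R, s ≠ 0 ∧ s • y = 0 := by
  rw [OreLocalization.zero_def, oreDiv_eq_iff] at h
  obtain ⟨u, v, h1, h2⟩ := h
  refine ⟨v, ?_, ?_⟩
  · intro hv
    rw [hv] at h2
    simp at h2
  · rw [← h1, smul_zero]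

/-- A module with `m` generators over a domain `R` satisfying both Ore conditions maps to `R ^ m`
with only torsion in the kernel: over the division ring of fractions the module becomes a space of
dimension at most `m`, and the finitely many coordinates of the generators can be cleared of
denominators by a multiplication on the right, which commutes with the left scalars. -/
theorem exists_linearMap_span_pi_ker_torsion
    (hr : ∀ a b : R, b ≠ 0 → ∃ u v : R, u ≠ 0 ∧ a * u = b * v) {m : ℕ} (x : Fin m → M) :
    ∃ T : Submodule.span R (Set.range x) →ₗ[R] (Fin m → R),
      ∀ y, T y = 0 → ∃ s : R, s ≠ 0 ∧ s • (y : M) = 0 := by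
  classical
  let ι : M →ₗ[R] M[R⁰⁻¹] :=
    { toFun := fun y => y /ₒ (1 : R⁰)
      map_add' := fun y z => add_oreDiv.symm
      map_smul' := fun r y => (smul_oreDiv_one r y).symm }
  -- the space spanned by the generators over the division ring of fractions
  let W : Submodule R[R⁰⁻¹] M[R⁰⁻¹] := Submodule.span _ (Set.range (ι ∘ x))
  have : FiniteDimensional R[R⁰⁻¹] W := FiniteDimensional.span_of_finite _ (Set.finite_range _)
  obtain ⟨L, hL⟩ : ∃ L : W →ₗ[R[R⁰⁻¹]] (Fin m → R[R⁰⁻¹]), Function.Injective L := by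
    refine finrank_le_iff_exists_linearMap.1 ?_
    rw [Module.finrank_fin_fun]
    exact (finrank_range_le_card (R := R[R⁰⁻¹]) (ι ∘ x)).trans_eq (Fintype.card_fin m)
  have hxW : ∀ y ∈ Submodule.span R (Set.range x), ι y ∈ W := by
    intro y hy
    induction hy using Submodule.span_induction with
    | mem y hy =>
      obtain ⟨i, rfl⟩ := hy
      exact Submodule.subset_span ⟨i, rfl⟩
    | zero => simp
    | add y z _ _ hy hz =>
      rw [map_add]
      exact W.add_mem hy hz
    | smul r y _ hy =>
      have : ι (r • y) = (r /ₒ (1 : R⁰)) • ι y := by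
        rw [map_smul, oreDiv_one_smul]
      rw [this]
      exact W.smul_mem _ hy
  let L' : Submodule.span R (Set.range x) →ₗ[R] (Fin m → R[R⁰⁻¹]) :=
    (L.restrictScalars R).comp ((ι.domRestrict _).codRestrict (W.restrictScalars R)
      fun y => hxW y y.2)
  have hxm : ∀ i, x i ∈ Submodule.span R (Set.range x) := fun i => Submodule.subset_span ⟨i, rfl⟩
  obtain ⟨d, hd, hden⟩ := OreLocalization.exists_common_right_denominator hr
    (Finset.univ : Finset (Fin m × Fin m)) (fun ij => L' ⟨x ij.1, hxm ij.1⟩ ij.2)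
  have hinj : Function.Injective (numeratorRingHom : R → R[R⁰⁻¹]) := numeratorHom_inj inf_le_left
  have hd' : (numeratorRingHom d : R[R⁰⁻¹]) ≠ 0 := (map_ne_zero_iff _ hinj).2 hd
  let N : (Fin m → R) →ₗ[R] (Fin m → R[R⁰⁻¹]) :=
    { toFun := fun v j => numeratorRingHom (v j)
      map_add' := fun v w => by ext; simp
      map_smul' := fun r v => by
        ext j
        exact (smul_oreDiv_one r (v j)).symm }
  have hN : Function.Injective N := fun v w h => funext fun j => hinj (congrFun h j)
  -- multiplication by `d` on the right is linear for the left scalars and clears all denominators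
  let L'' : Submodule.span R (Set.range x) →ₗ[R] (Fin m → R[R⁰⁻¹]) :=
    { toFun := fun y j => L' y j * numeratorRingHom d
      map_add' := fun y z => by
        ext j
        simp [add_mul]
      map_smul' := fun r y => by
        ext j
        simp [smul_mul_assoc] }
  have hrange : ∀ y, L'' y ∈ LinearMap.range N := by
    rintro ⟨y, hy⟩
    induction hy using Submodule.span_induction with
    | mem y hy =>
      obtain ⟨i, rfl⟩ := hy
      choose p hp using fun j => hden (i, j) (Finset.mem_univ _)
      exact ⟨p, funext fun j => (hp j).symm⟩
    | zero =>
      have := (LinearMap.range N).zero_mem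
      rwa [← map_zero L''] at this
    | add y z hy hz ihy ihz =>
      have := (LinearMap.range N).add_mem ihy ihz
      rwa [← map_add] at this
    | smul r y hy ih =>
      have := (LinearMap.range N).smul_mem r ih
      rwa [← map_smul] at this
  refine ⟨(LinearEquiv.ofInjective N hN).symm.toLinearMap.comp
    (L''.codRestrict (LinearMap.range N) hrange), fun y hy => ?_⟩
  have hy1 : L'' y = 0 := by
    have := (LinearEquiv.map_eq_zero_iff (LinearEquiv.ofInjective N hN).symm).1 hy
    exact congrArg Subtype.val this
  have hy2 : L' y = 0 := funext fun j => (mul_eq_zero.1 (congrFun hy1 j)).resolve_right hd'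
  have hy3 := (map_eq_zero_iff L hL).1 hy2
  exact OreLocalization.exists_smul_eq_zero_of_oreDiv_one_eq_zero (congrArg Subtype.val hy3)

end OreModule

/-! ### Unique products in iterated wreath products -/

section UniqueProducts

/-- The class of groups with unique products is closed under extensions. -/
theorem UniqueProds.of_ker {G Q : Type*} [Group G] [Group Q] [UniqueProds Q] (f : G →* Q)
    [UniqueProds f.ker] : UniqueProds G where
  uniqueMul_of_nonempty {A B} hA hB := by
    classical
    obtain ⟨p, hp, q, hq, hpq⟩ := UniqueProds.uniqueMul_of_nonempty (hA.image f) (hB.image f)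
    obtain ⟨a₀, ha₀, rfl⟩ := Finset.mem_image.1 hp
    obtain ⟨b₀, hb₀, rfl⟩ := Finset.mem_image.1 hq
    let A' : Finset f.ker := (A.image (a₀⁻¹ * ·)).subtype (· ∈ f.ker)
    let B' : Finset f.ker := (B.image (· * b₀⁻¹)).subtype (· ∈ f.ker)
    have hA' : A'.Nonempty := ⟨1, by simp [A', ha₀]⟩
    have hB' : B'.Nonempty := ⟨1, by simp [B', hb₀]⟩
    obtain ⟨a, ha, b, hb, hab⟩ := UniqueProds.uniqueMul_of_nonempty hA' hB'
    have haA : a₀ * (a : G) ∈ A := by simpa [A'] using ha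
    have hbB : (b : G) * b₀ ∈ B := by simpa [B'] using hb
    refine ⟨a₀ * a, haA, b * b₀, hbB, UniqueMul.of_image_filter (f : G →ₙ* Q)
      (aH := f a₀) (bH := f b₀) ?_ ?_ hpq ?_⟩
    · simp [MonoidHom.mem_ker.1 a.2]
    · simp [MonoidHom.mem_ker.1 b.2]
    · intro x y hx hy hxy
      replace hx : x ∈ A ∧ f x = f a₀ := Finset.mem_filter.1 hx
      replace hy : y ∈ B ∧ f y = f b₀ := Finset.mem_filter.1 hy
      have hx' : a₀⁻¹ * x ∈ f.ker := by simp [MonoidHom.mem_ker, hx.2]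
      have hy' : y * b₀⁻¹ ∈ f.ker := by simp [MonoidHom.mem_ker, hy.2]
      obtain ⟨h1, h2⟩ := @hab ⟨_, hx'⟩ ⟨_, hy'⟩ (by simpa [A'] using hx.1)
        (by simpa [B'] using hy.1) (Subtype.ext (by
          have : a₀⁻¹ * (x * y) * b₀⁻¹ = a₀⁻¹ * (a₀ * a * (b * b₀)) * b₀⁻¹ := by rw [hxy]
          simpa [mul_assoc] using this))
      constructor
      · rw [← congrArg Subtype.val h1, mul_inv_cancel_left]
      · rw [← congrArg Subtype.val h2, inv_mul_cancel_right]

/-- The projection of the restricted wreath product `A ≀ B` to `B`. -/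
def restrictedWreathRight (A B : Type*) [Group A] [Group B] : restrictedWreath A B →* B :=
  RegularWreathProduct.rightHom.comp (restrictedWreath A B).subtype

/-- The complement `B` of the base group in the restricted wreath product `A ≀ B`. -/
def restrictedWreathInl (A B : Type*) [Group A] [Group B] : B →* restrictedWreath A B :=
  RegularWreathProduct.inl.codRestrict _ fun b => by simp [restrictedWreath]

theorem restrictedWreathInl_injective (A B : Type*) [Group A] [Group B] :
    Function.Injective (restrictedWreathInl A B) := fun _ _ h =>
  congrArg (restrictedWreathRight A B) h

instance uniqueProds_restrictedWreath (A B : Type*) [Group A] [Group B] [UniqueProds A]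
    [UniqueProds B] : UniqueProds (restrictedWreath A B) := by
  let g : (restrictedWreathRight A B).ker →ₙ* (B → A) :=
    { toFun := fun w => w.1.1.left
      map_mul' := fun v w => by
        have hv : v.1.1.right = 1 := v.2
        simp [hv] }
  have hg : Function.Injective g := fun v w h => by
    have hv : v.1.1.right = 1 := v.2
    have hw : w.1.1.right = 1 := w.2
    exact Subtype.ext (Subtype.ext (RegularWreathProduct.ext h (hv.trans hw.symm)))
  have := UniqueProds.of_injective_mulHom g hg inferInstance
  exact UniqueProds.of_ker (restrictedWreathRight A B)

instance uniqueProds_iteratedWreath (m n : ℕ) : UniqueProds (iteratedWreath m n) := by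
  induction n with
  | zero => exact inferInstanceAs (UniqueProds (FreeAb m))
  | succ n ih => exact inferInstanceAs (UniqueProds (restrictedWreath (FreeAb m) _))

theorem exists_injective_iteratedWreath_succ (m n : ℕ) :
    ∃ f : iteratedWreath m n →* iteratedWreath m (n + 1), Function.Injective f :=
  ⟨restrictedWreathInl (FreeAb m) (iteratedWreath m n), restrictedWreathInl_injective _ _⟩

theorem exists_injective_iteratedWreath_of_le (m : ℕ) {k n : ℕ} (h : k ≤ n) :
    ∃ f : iteratedWreath m k →* iteratedWreath m n, Function.Injective f := by
  induction n, h using Nat.le_induction with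
  | base => exact ⟨MonoidHom.id _, Function.injective_id⟩
  | succ n _ ih =>
    obtain ⟨f, hf⟩ := ih
    obtain ⟨g, hg⟩ := exists_injective_iteratedWreath_succ m n
    exact ⟨g.comp f, hg.comp hf⟩

/-- The wreath product of `A` with the trivial group is `A`. -/
def restrictedWreathPUnit (A : Type*) [Group A] : restrictedWreath A PUnit.{1} ≃* A where
  toFun w := w.1.left 1
  invFun a := ⟨⟨fun _ => a, 1⟩, Set.toFinite _⟩
  left_inv _ := rfl
  right_inv _ := rfl
  map_mul' _ _ := rfl

end UniqueProducts

/-! ### Torsion-free factors and principal chains -/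

section Factors

variable {G : Type*} [Group G]

/-- `H / (H ∩ K)` is a torsion-free factor of `G`, for subgroups `H` and `K` whose normality is
part of the claim. -/
def HasTorsionFreeFactor (H K : Subgroup G) : Prop :=
  ∃ (_ : H.Normal) (_ : K.Normal), IsTorsionFreeFactor H K

theorem factorConjQuot_mk (H K : Subgroup G) [H.Normal] [K.Normal]
    (hab : ∀ a b : H ⧸ K.subgroupOf H, a * b = b * a) (g : G) (a : H) :
    factorConjQuot H K hab (g : G ⧸ H) (a : H ⧸ K.subgroupOf H) =
      ((MulAut.conjNormal g a : H) : H ⧸ K.subgroupOf H) := rfl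

/-- A homomorphism from the factor to an abelian group turns the exponential notation into a sum. -/
theorem toAdd_map_factorPow (H K : Subgroup G) [H.Normal] [K.Normal]
    (hab : ∀ a b : H ⧸ K.subgroupOf H, a * b = b * a) {M : Type*} [AddCommGroup M]
    (θ : H ⧸ K.subgroupOf H →* Multiplicative M) (x : H ⧸ K.subgroupOf H)
    (u : MonoidAlgebra ℤ (G ⧸ H)) :
    (θ (factorPow H K hab x u)).toAdd =
      u.coeff.sum fun h c => c • (θ (factorConjQuot H K hab h⁻¹ x)).toAdd := by
  let _ : CommGroup (H ⧸ K.subgroupOf H) := { (inferInstance : Group _) with mul_comm := hab }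
  have h := map_finsuppProd θ u.coeff fun h c => (factorConjQuot H K hab h⁻¹ x) ^ c
  simp only [map_zpow] at h
  exact congrArg Multiplicative.toAdd h

/-- The factor, written additively. -/
theorem IsTorsionFreeFactor.exists_injective_toMultiplicative.{u} {G : Type u} [Group G]
    {H K : Subgroup G} [H.Normal] [K.Normal] (hT : IsTorsionFreeFactor H K) :
    ∃ (M : Type u) (_ : AddCommGroup M) (θ : H ⧸ K.subgroupOf H →* Multiplicative M),
      Function.Injective θ := by
  let _ : CommGroup (H ⧸ K.subgroupOf H) :=
    { (inferInstance : Group (H ⧸ K.subgroupOf H)) with mul_comm := hT.comm }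
  exact ⟨Additive (H ⧸ K.subgroupOf H), inferInstance, MonoidHom.id _, Function.injective_id⟩

/-- A chain of normal subgroups descending from `G` to the given subgroup, strictly and with
torsion-free factors. -/
inductive HasPrincipalChain : Subgroup G → Prop
  | top : HasPrincipalChain ⊤
  | step {H K : Subgroup G} : HasPrincipalChain H → K < H → HasTorsionFreeFactor H K →
      HasPrincipalChain K

theorem HasPrincipalChain.exists_series {K : Subgroup G} (h : HasPrincipalChain K) :
    K.Normal ∧ ∃ (n : ℕ) (S : Fin (n + 1) → Subgroup G), S 0 = ⊤ ∧ S (Fin.last n) = K ∧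
      ∀ i : Fin n, S i.succ < S i.castSucc ∧ HasTorsionFreeFactor (S i.castSucc) (S i.succ) := by
  induction h with
  | top => exact ⟨inferInstance, 0, fun _ => ⊤, rfl, rfl, fun i => i.elim0⟩
  | @step H K _ hlt hf ih =>
    obtain ⟨_, n, S, h0, hl, hS⟩ := ih
    refine ⟨hf.2.1, n + 1, Fin.snoc S K, ?_, ?_, fun i => ?_⟩
    · rw [← Fin.castSucc_zero, Fin.snoc_castSucc, h0]
    · rw [Fin.snoc_last]
    · induction i using Fin.lastCases with
      | last =>
        rw [Fin.succ_last, Fin.snoc_last, Fin.snoc_castSucc, hl]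
        exact ⟨hlt, hf⟩
      | cast i =>
        rw [Fin.succ_castSucc, Fin.snoc_castSucc, Fin.snoc_castSucc]
        exact hS i

theorem HasPrincipalChain.isRigid (h : HasPrincipalChain (⊥ : Subgroup G)) : IsRigid G := by
  obtain ⟨_, n, S, h0, hl, hS⟩ := h.exists_series
  have hn : ∀ i, (S i).Normal := fun i => by
    induction i using Fin.lastCases with
    | last => rw [hl]; infer_instance
    | cast i => exact (hS i).2.1
  exact ⟨n, S, hn, h0, hl, fun i => (hS i).1, fun i => (hS i).2.2.2⟩

end Factors

/-! ### Rigidity of subgroups of iterated wreath products -/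

section WreathRigid

variable {X C : Type*} [Group X] [Group C] {m : ℕ}

/-- The last factor of the series of `A_m ≀ C`, intersected with a group `X`: the base group is a
free module over `ℤ[C]`, a ring without zero divisors. -/
theorem hasTorsionFreeFactor_of_restrictedWreath [UniqueProds C]
    (f : X →* restrictedWreath (FreeAb m) C) :
    HasTorsionFreeFactor ((restrictedWreathRight _ _).comp f).ker f.ker := by
  set p : X →* C := (restrictedWreathRight _ _).comp f with hp
  have hright : ∀ a : p.ker, (f a).1.right = 1 := fun a => a.2
  -- the coordinates of the base group as functions on the factor
  let θ : p.ker →* (C → FreeAb m) :=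
    { toFun := fun a => (f a).1.left
      map_one' := by simp
      map_mul' := fun a b => by simp [hright] }
  have hθ : ∀ a : p.ker, θ a = 1 ↔ a ∈ f.ker.subgroupOf p.ker := by
    intro a
    rw [Subgroup.mem_subgroupOf, MonoidHom.mem_ker, Subtype.ext_iff, RegularWreathProduct.ext_iff]
    exact ⟨fun h => ⟨h, hright a⟩, fun h => h.1⟩
  let Θ : p.ker ⧸ f.ker.subgroupOf p.ker →* (C → FreeAb m) :=
    QuotientGroup.lift _ θ fun a ha => (hθ a).2 ha
  have hΘ : Function.Injective Θ := by
    rw [injective_iff_map_eq_one]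
    intro x
    induction x using QuotientGroup.induction_on with
    | H a => exact fun h => (QuotientGroup.eq_one_iff a).2 ((hθ a).1 h)
  have hab : ∀ a b : p.ker ⧸ f.ker.subgroupOf p.ker, a * b = b * a := fun a b =>
    hΘ (by rw [map_mul, map_mul, mul_comm])
  refine ⟨inferInstance, inferInstance, hab, fun x u hu => ?_⟩
  induction x using QuotientGroup.induction_on with
  | H a =>
    by_contra! hcon
    obtain ⟨hu0, ha⟩ := hcon
    obtain ⟨c, hc⟩ := Function.ne_iff.1 fun h => ha (hΘ (h.trans (map_one Θ).symm))
    obtain ⟨j, hj⟩ := Function.ne_iff.1 fun h => hc (Multiplicative.toAdd.injective h)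
    have hfin : (Function.support fun c => (θ a c).toAdd j).Finite := by
      refine (f a).2.subset fun c hc hc' => hc ?_
      change ((f a).1.left c).toAdd j = 0
      rw [hc']
      rfl
    -- the `j`-th coordinate of `a` in `ℤ[C]`, and `u` after inversion of the group elements
    let v : MonoidAlgebra ℤ C := .ofCoeff (Finsupp.ofSupportFinite _ hfin)
    let q : X ⧸ p.ker → C := fun h => (QuotientGroup.kerLift p h)⁻¹
    have hq : Function.Injective q := inv_injective.comp (QuotientGroup.kerLift_injective p)
    let w : MonoidAlgebra ℤ C := .ofCoeff (u.coeff.mapDomain q)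
    have hv : v ≠ 0 := fun h => hj (by
      have := congrArg (fun z => z.coeff c) h
      exact this)
    have hw : w ≠ 0 := fun h => hu0 (by
      have h1 : u.coeff.mapDomain q = Finsupp.mapDomain q 0 := congrArg MonoidAlgebra.coeff h
      exact MonoidAlgebra.coeff_eq_zero.1 (Finsupp.mapDomain_injective hq h1))
    refine mul_ne_zero hw hv ?_
    ext c'
    let ev : (C → FreeAb m) →* Multiplicative ℤ :=
      { toFun := fun g => Multiplicative.ofAdd ((g c').toAdd j)
        map_one' := rfl
        map_mul' := fun _ _ => rfl }
    have h2 := toAdd_map_factorPow _ _ hab (ev.comp Θ) a u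
    rw [hu, map_one] at h2
    have hw' : w = u.coeff.sum fun h c => MonoidAlgebra.single (q h) c := by
      apply MonoidAlgebra.coeff_injective
      rw [MonoidAlgebra.coeff_finsuppSum]
      rfl
    have hconj : ∀ h : X ⧸ p.ker, (ev.comp Θ (factorConjQuot _ _ hab h⁻¹ a)).toAdd =
        v.coeff ((q h)⁻¹ * c') := by
      intro h
      induction h using QuotientGroup.induction_on with
      | H g =>
        change ((f (g⁻¹ * a * g⁻¹⁻¹)).1.left c').toAdd j = ((f a).1.left ((p g)⁻¹⁻¹ * c')).toAdd j
        have hpg : (f g).1.right = p g := rfl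
        simp [hright, hpg]
    rw [hw', Finsupp.sum_mul, MonoidAlgebra.coeff_finsuppSum, Finsupp.sum_apply]
    simp only [MonoidAlgebra.coeff_single_mul_apply, ← hconj]
    exact h2.symm

variable (X) in
/-- The kernels of the projections of a subgroup of `W(m, n)` to `W(m, n - 1)`, `W(m, n - 2)`, …
form a principal chain once repetitions are removed. -/
theorem hasPrincipalChain_ker_iteratedWreath (n : ℕ) (f : X →* iteratedWreath m n) :
    HasPrincipalChain f.ker := by
  have hstep : ∀ (C : Type) [Group C] [UniqueProds C] (f : X →* restrictedWreath (FreeAb m) C),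
      HasPrincipalChain ((restrictedWreathRight _ _).comp f).ker → HasPrincipalChain f.ker := by
    intro C _ _ f h
    have hle : f.ker ≤ ((restrictedWreathRight _ _).comp f).ker := by
      rw [← MonoidHom.comap_ker]
      exact f.ker_le_comap _
    rcases hle.eq_or_lt with heq | hlt
    · rwa [heq]
    · exact h.step hlt (hasTorsionFreeFactor_of_restrictedWreath f)
  induction n with
  | zero =>
    -- `A_m` is the wreath product of `A_m` with the trivial group
    have hzero : ∀ f : X →* FreeAb m, HasPrincipalChain f.ker := by
      intro f
      let e := (restrictedWreathPUnit (FreeAb m)).symm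
      have htop : ((restrictedWreathRight _ _).comp (e.toMonoidHom.comp f)).ker = ⊤ :=
        eq_top_iff.2 fun x _ => Subsingleton.elim (α := PUnit) _ _
      have h := hstep PUnit (e.toMonoidHom.comp f) (htop ▸ .top)
      rwa [MonoidHom.ker_comp_of_injective f e.toMonoidHom e.injective] at h
    exact hzero f
  | succ n ih => exact hstep (iteratedWreath m n) f (ih _)

theorem isRigid_of_injective_iteratedWreath {n : ℕ} (f : X →* iteratedWreath m n)
    (hf : Function.Injective f) : IsRigid X := by
  have h := hasPrincipalChain_ker_iteratedWreath X n f
  rw [(MonoidHom.ker_eq_bot_iff f).2 hf] at h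
  exact h.isRigid

end WreathRigid

/-! ### The Magnus embedding for torsion-free factors -/

section Magnus

open scoped nonZeroDivisors

variable {G : Type*} [Group G]

/-- The representation of `B` by left translations on all functions from `B` to `M`. -/
def translationRep (B M : Type*) [Group B] [AddCommGroup M] : Representation ℤ B (B → M) where
  toFun b :=
    { toFun := fun f x => f (b⁻¹ * x)
      map_add' := fun _ _ => rfl
      map_smul' := fun _ _ => rfl }
  map_one' := by
    ext f x
    simp
  map_mul' b c := by
    ext f x
    simp [mul_assoc]

/-- A derivation of an `m`-generated group with values in an arbitrary `ℤ[B]`-module can be replaced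
by one with values in `ℤ[B] ^ m` that vanishes only where the values of the original one are torsion
elements. -/
theorem exists_derivation_pi {B : Type*} [Group B] [UniqueProds B] (hB : IsFolner B)
    {M : Type*} [AddCommGroup M] [Module (MonoidAlgebra ℤ B) M] (π : G →* B) (δ : G → M)
    (hδ : ∀ x y, δ (x * y) = δ x + MonoidAlgebra.single (π x) (1 : ℤ) • δ y)
    {m : ℕ} (hG : IsGeneratedBy G m) :
    ∃ d : G → Fin m → MonoidAlgebra ℤ B,
      (∀ x y j, d (x * y) j = d x j + MonoidAlgebra.single (π x) 1 * d y j) ∧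
      (∀ x, δ x = 0 → d x = 0) ∧ ∀ x, d x = 0 → ∃ s : MonoidAlgebra ℤ B, s ≠ 0 ∧ s • δ x = 0 := by
  obtain ⟨g, hg⟩ := hG
  have hne : Nonempty (OreLocalization.OreSet (MonoidAlgebra ℤ B)⁰) := by
    rw [OreLocalization.nonempty_oreSet_iff_of_noZeroDivisors]
    intro r s
    obtain ⟨u, v, hu, huv⟩ := hB.exists_mul_eq_mul r (nonZeroDivisors.ne_zero s.2)
    exact ⟨v, ⟨u, mem_nonZeroDivisors_of_ne_zero hu⟩, huv⟩
  obtain ⟨_⟩ := hne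
  obtain ⟨T, hT⟩ := exists_linearMap_span_pi_ker_torsion
    (fun a _ => hB.exists_mul_eq_mul' a) (fun i => δ (g i))
  have hδ1 : δ 1 = 0 := by
    have := hδ 1 1
    rw [mul_one, map_one, ← MonoidAlgebra.one_def, one_smul] at this
    exact left_eq_add.1 this
  have hmem : ∀ x, δ x ∈ Submodule.span (MonoidAlgebra ℤ B) (Set.range fun i => δ (g i)) := by
    intro x
    have hx : x ∈ Subgroup.closure (Set.range g) := hg ▸ Subgroup.mem_top x
    induction hx using Subgroup.closure_induction with
    | mem x hx =>
      obtain ⟨i, rfl⟩ := hx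
      exact Submodule.subset_span ⟨i, rfl⟩
    | one =>
      rw [hδ1]
      exact Submodule.zero_mem _
    | mul x y _ _ hx hy =>
      rw [hδ]
      exact Submodule.add_mem _ hx (Submodule.smul_mem _ _ hy)
    | inv x _ hx =>
      have h : δ x⁻¹ = -(MonoidAlgebra.single (π x⁻¹) (1 : ℤ) • δ x) := by
        rw [eq_neg_iff_add_eq_zero, ← hδ, inv_mul_cancel, hδ1]
      rw [h]
      exact Submodule.neg_mem _ (Submodule.smul_mem _ _ hx)
  refine ⟨fun x => T ⟨δ x, hmem x⟩, fun x y j => ?_, fun x hx => ?_, fun x hx => hT _ hx⟩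
  · have h : (⟨δ (x * y), hmem _⟩ : Submodule.span (MonoidAlgebra ℤ B) (Set.range fun i => δ (g i)))
        = ⟨δ x, hmem x⟩ + MonoidAlgebra.single (π x) (1 : ℤ) • ⟨δ y, hmem y⟩ := Subtype.ext (hδ x y)
    dsimp only
    rw [h, map_add, map_smul]
    rfl
  · have h : (⟨δ x, hmem x⟩ :
        Submodule.span (MonoidAlgebra ℤ B) (Set.range fun i => δ (g i))) = 0 := Subtype.ext hx
    dsimp only
    rw [h, map_zero]

/-- The derivation underlying the Magnus embedding. It comes from the Kaloujnine–Krasner derivation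
`g ↦ (b ↦ σ(b)⁻¹ g σ(g⁻¹ b))` into the functions from `G / H` to `H / K`, for a section `σ` of
`G → G / H`. Its restriction to `H` is a `ℤ[G / H]`-linear embedding of the factor `H / K`, so the
factor, being torsion-free, survives the passage to `ℤ[G / H] ^ m`. -/
theorem exists_derivation_of_isTorsionFreeFactor (H K : Subgroup G) [H.Normal] [K.Normal]
    (hT : IsTorsionFreeFactor H K) (hB : IsFolner (G ⧸ H)) [UniqueProds (G ⧸ H)] {m : ℕ}
    (hG : IsGeneratedBy G m) :
    ∃ d : G → Fin m → MonoidAlgebra ℤ (G ⧸ H),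
      (∀ x y j, d (x * y) j = d x j + MonoidAlgebra.single (x : G ⧸ H) 1 * d y j) ∧
      ∀ a ∈ H, d a = 0 ↔ a ∈ K := by
  obtain ⟨M, _, θ, hθ⟩ := hT.exists_injective_toMultiplicative
  let σ : G ⧸ H → G := Quotient.out
  have hσ : ∀ b, (σ b : G ⧸ H) = b := fun b => Quotient.out_eq' b
  have hmem : ∀ (g : G) (b : G ⧸ H), (σ b)⁻¹ * g * σ ((g : G ⧸ H)⁻¹ * b) ∈ H := by
    intro g b
    rw [← QuotientGroup.eq_one_iff]
    simp [hσ]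
  let δ : G → (translationRep (G ⧸ H) M).asModule := fun g b =>
    (θ ((⟨_, hmem g b⟩ : H) : H ⧸ K.subgroupOf H)).toAdd
  have hδ : ∀ x y, δ (x * y) =
      δ x + MonoidAlgebra.single (QuotientGroup.mk' H x) (1 : ℤ) • δ y := by
    intro x y
    rw [Representation.single_smul, one_smul]
    funext b
    change (θ _).toAdd = (θ _).toAdd + (θ _).toAdd
    rw [← toAdd_mul, ← map_mul, ← QuotientGroup.mk_mul]
    congr 4
    simp [mul_assoc]
  -- on `H` the derivation is conjugation, and it is linear over `ℤ[G / H]`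
  have hδH : ∀ (a : H) (b : G ⧸ H), δ a b⁻¹ =
      (θ (factorConjQuot H K hT.comm b (a : H ⧸ K.subgroupOf H))).toAdd := by
    intro a b
    have hb : b = (((σ b⁻¹)⁻¹ : G) : G ⧸ H) := by simp [hσ]
    conv_rhs => rw [hb, factorConjQuot_mk]
    have ha : ((a : G) : G ⧸ H) = 1 := (QuotientGroup.eq_one_iff _).2 a.2
    change (θ _).toAdd = _
    congr 4
    change _ = (σ b⁻¹)⁻¹ * (a : G) * ((σ b⁻¹)⁻¹)⁻¹
    simp [ha]
  have hδsmul : ∀ (a : H) (s : MonoidAlgebra ℤ (G ⧸ H)), (s • δ a) 1 =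
      (θ (factorPow H K hT.comm a (.ofCoeff (s.coeff.mapDomain (·⁻¹))))).toAdd := by
    intro a s
    rw [toAdd_map_factorPow, Finsupp.sum_mapDomain_index_inj inv_injective]
    conv_lhs => rw [← MonoidAlgebra.sum_coeff_single s, Finsupp.sum, Finset.sum_smul]
    let ev : (translationRep (G ⧸ H) M).asModule →+ M :=
      { toFun := fun f => f 1
        map_zero' := rfl
        map_add' := fun _ _ => rfl }
    refine (map_sum ev _ _).trans ?_
    refine Finset.sum_congr rfl fun h _ => ?_
    dsimp only
    rw [inv_inv, ← hδH, Representation.single_smul]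
    change s.coeff h • δ a (h⁻¹ * 1) = _
    rw [mul_one]
  obtain ⟨d, hd, hd0, hds⟩ := exists_derivation_pi hB (QuotientGroup.mk' H) δ hδ hG
  refine ⟨d, hd, fun a ha => ⟨fun h => ?_, fun h => hd0 a ?_⟩⟩
  · obtain ⟨s, hs, hsa⟩ := hds a h
    have h1 := hδsmul ⟨a, ha⟩ s
    rw [hsa] at h1
    have h2 : factorPow H K hT.comm (⟨a, ha⟩ : H) (.ofCoeff (s.coeff.mapDomain (·⁻¹))) = 1 :=
      hθ ((Multiplicative.toAdd.injective h1.symm).trans (map_one θ).symm)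
    rcases hT.no_torsion _ _ h2 with h3 | h3
    · refine absurd ?_ hs
      have h4 : s.coeff.mapDomain (·⁻¹) = Finsupp.mapDomain (·⁻¹) 0 :=
        congrArg MonoidAlgebra.coeff h3
      exact MonoidAlgebra.coeff_eq_zero.1 (Finsupp.mapDomain_injective inv_injective h4)
    · exact Subgroup.mem_subgroupOf.1 ((QuotientGroup.eq_one_iff _).1 h3)
  · funext b
    have h1 : ((⟨a, ha⟩ : H) : H ⧸ K.subgroupOf H) = 1 :=
      (QuotientGroup.eq_one_iff _).2 (Subgroup.mem_subgroupOf.2 h)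
    have h2 := hδH ⟨a, ha⟩ b⁻¹
    rw [inv_inv, h1, map_one, map_one] at h2
    exact h2

/-- If `G / H` embeds into `C`, then `G / K` embeds into `A_m ≀ C`. -/
theorem exists_hom_restrictedWreath_ker_eq {C : Type*} [Group C] [UniqueProds C] (φ : G →* C)
    (K : Subgroup G) [K.Normal] (hK : K ≤ φ.ker) (hT : IsTorsionFreeFactor φ.ker K)
    (hB : IsFolner (G ⧸ φ.ker)) {m : ℕ} (hG : IsGeneratedBy G m) :
    ∃ f : G →* restrictedWreath (FreeAb m) C, f.ker = K := by
  have hinj := QuotientGroup.kerLift_injective φ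
  have : UniqueProds (G ⧸ φ.ker) :=
    UniqueProds.of_injective_mulHom (QuotientGroup.kerLift φ : G ⧸ φ.ker →ₙ* C) hinj inferInstance
  obtain ⟨d, hd, hdK⟩ := exists_derivation_of_isTorsionFreeFactor φ.ker K hT hB hG
  let ψ := MonoidAlgebra.mapDomainRingHom ℤ (QuotientGroup.kerLift φ)
  have hψ : Function.Injective ψ := MonoidAlgebra.mapDomain_injective hinj
  -- the coefficients of the derivation in `ℤ[C]` are the values of the function part
  let f : G →* restrictedWreath (FreeAb m) C := MonoidHom.mk'
    (fun x => ⟨⟨fun c => Multiplicative.ofAdd fun j => (ψ (d x j)).coeff c, φ x⟩, by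
      refine (Set.finite_iUnion fun j => (ψ (d x j)).coeff.hasFiniteSupport).subset fun c hc => ?_
      obtain ⟨j, hj⟩ := Function.ne_iff.1 fun h => hc (Multiplicative.toAdd.injective h)
      exact Set.mem_iUnion.2 ⟨j, hj⟩⟩) (fun x y => by
    refine Subtype.ext (RegularWreathProduct.ext ?_ (map_mul φ x y))
    funext c
    refine Multiplicative.toAdd.injective (funext fun j => ?_)
    change (ψ (d (x * y) j)).coeff c = (ψ (d x j)).coeff c + (ψ (d y j)).coeff ((φ x)⁻¹ * c)
    have hs : ψ (MonoidAlgebra.single (x : G ⧸ φ.ker) 1) = MonoidAlgebra.single (φ x) 1 := by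
      simp [ψ]
    rw [hd, map_add, map_mul, hs, MonoidAlgebra.coeff_add, Finsupp.add_apply,
      MonoidAlgebra.coeff_single_mul_apply, one_mul])
  refine ⟨f, Subgroup.ext fun x => ⟨fun hx => ?_, fun hx => ?_⟩⟩
  · have hxφ : φ x = 1 := congrArg (fun w => w.1.right) hx
    refine (hdK x hxφ).1 (funext fun j => hψ ?_)
    rw [Pi.zero_apply, map_zero]
    ext c
    exact congrFun (congrArg Multiplicative.toAdd (congrFun (congrArg (fun w => w.1.left) hx) c)) j
  · refine Subtype.ext (RegularWreathProduct.ext ?_ (hK hx))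
    funext c
    refine Multiplicative.toAdd.injective (funext fun j => ?_)
    change (ψ (d x j)).coeff c = 0
    rw [(hdK x (hK hx)).2 hx, Pi.zero_apply, map_zero]
    rfl

end Magnus

/-! ### The length of a principal series -/

section Length

open scoped commutatorElement

variable {G : Type*} [Group G]

/-- Commutation with an element outside `H` is the action of `h̄ - 1 ≠ 0` on the factor. -/
theorem IsTorsionFreeFactor.commutator_notMem {H K : Subgroup G} [H.Normal] [K.Normal]
    (hT : IsTorsionFreeFactor H K) {x y : G} (hx : x ∉ H) (hy : y ∈ H) (hyK : y ∉ K) :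
    ⁅x, y⁆ ∉ K := by
  intro hK
  have hx1 : ((x⁻¹ : G) : G ⧸ H) ≠ 1 := fun h =>
    hx (inv_mem_iff.1 ((QuotientGroup.eq_one_iff _).1 h))
  let u : MonoidAlgebra ℤ (G ⧸ H) :=
    MonoidAlgebra.single ((x⁻¹ : G) : G ⧸ H) 1 + MonoidAlgebra.single 1 (-1)
  have hu : u ≠ 0 := by
    intro h
    have h1 : (MonoidAlgebra.single ((x⁻¹ : G) : G ⧸ H) (1 : ℤ)).coeff 1 + -1 = 0 := by
      simpa [u] using congrArg (fun z => z.coeff 1) h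
    rw [MonoidAlgebra.coeff_single, Finsupp.single_eq_of_ne hx1.symm] at h1
    norm_num at h1
  have hpow : factorPow H K hT.comm ((⟨y, hy⟩ : H) : H ⧸ K.subgroupOf H) u = 1 := by
    obtain ⟨M, _, θ, hθ⟩ := hT.exists_injective_toMultiplicative
    refine hθ (Multiplicative.toAdd.injective ?_)
    rw [toAdd_map_factorPow, MonoidAlgebra.coeff_add, Finsupp.sum_add_index' (by simp)
      (fun _ _ _ => add_smul _ _ _), MonoidAlgebra.coeff_single, MonoidAlgebra.coeff_single,
      Finsupp.sum_single_index (zero_zsmul _), Finsupp.sum_single_index (zero_zsmul _), one_smul,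
      neg_one_smul, inv_one, map_one, MulAut.one_apply, ← toAdd_inv, ← toAdd_mul, ← map_inv,
      ← map_mul, ← QuotientGroup.mk_inv, factorConjQuot_mk, ← QuotientGroup.mk_inv,
      ← QuotientGroup.mk_mul, (QuotientGroup.eq_one_iff _).2, map_one]
    rw [Subgroup.mem_subgroupOf]
    change x⁻¹⁻¹ * y * x⁻¹⁻¹⁻¹ * y⁻¹ ∈ K
    rwa [inv_inv, ← commutatorElement_def]
  rcases hT.no_torsion _ _ hpow with h | h
  · exact hu h
  · exact hyK (Subgroup.mem_subgroupOf.1 ((QuotientGroup.eq_one_iff _).1 h))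

/-- If `x` lies in the `i`-th derived subgroup but not in `S (i + 1)`, and `y` lies in `S (i + 1)`
but not in `S (i + 2)`, then the double commutator `⁅x, ⁅x, y⁆⁆` lies in the next derived subgroup
but not in `S (i + 2)`. -/
theorem IsPrincipalSeries.exists_mem_derivedSeries {n : ℕ} {S : Fin (n + 1) → Subgroup G}
    (hS : IsPrincipalSeries S) (i : Fin n) : ∃ x ∈ derivedSeries G i, x ∉ S i.succ := by
  obtain ⟨i, hi⟩ := i
  induction i with
  | zero =>
    obtain ⟨x, _, hx⟩ := SetLike.exists_of_lt (hS.succ_lt ⟨0, hi⟩)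
    exact ⟨x, Subgroup.mem_top x, hx⟩
  | succ i ih =>
    obtain ⟨x, hx, hxS⟩ := ih (by omega)
    obtain ⟨y, hy, hyS⟩ := SetLike.exists_of_lt (hS.succ_lt ⟨i + 1, hi⟩)
    have h1 := hS.normal (Fin.castSucc ⟨i + 1, hi⟩)
    have h2 := hS.normal (Fin.succ ⟨i + 1, hi⟩)
    have hT : IsTorsionFreeFactor (S (Fin.castSucc ⟨i + 1, hi⟩)) (S (Fin.succ ⟨i + 1, hi⟩)) :=
      hS.factor ⟨i + 1, hi⟩
    have hc := hT.commutator_notMem hxS hy hyS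
    have hcS : ⁅x, y⁆ ∈ S (Fin.castSucc ⟨i + 1, hi⟩) :=
      Subgroup.commutator_le_right (⊤ : Subgroup G) _
        (Subgroup.commutator_mem_commutator (Subgroup.mem_top x) hy)
    have hcD : ⁅x, y⁆ ∈ derivedSeries G i :=
      Subgroup.commutator_le_left _ (⊤ : Subgroup G)
        (Subgroup.commutator_mem_commutator hx (Subgroup.mem_top y))
    exact ⟨⁅x, ⁅x, y⁆⁆, Subgroup.commutator_mem_commutator hx hcD,
      hT.commutator_notMem hxS hcS hc⟩

theorem IsPrincipalSeries.length_le {n c : ℕ} {S : Fin (n + 1) → Subgroup G}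
    (hS : IsPrincipalSeries S) (hc : derivedSeries G c = ⊥) : n ≤ c := by
  by_contra! h
  obtain ⟨x, hx, hxS⟩ := hS.exists_mem_derivedSeries ⟨c, h⟩
  rw [Fin.val_mk, hc, Subgroup.mem_bot] at hx
  exact hxS (hx ▸ (S _).one_mem)

end Length

/-! ### The embedding into iterated wreath products -/

section Embedding

variable {G : Type*} [Group G]

/-- Each term `S (i + 1)` of a principal series is the kernel of a homomorphism to `W(m, i)`, by
induction on `i` from the Magnus embedding for the factor `S i / S (i + 1)`. -/
theorem IsPrincipalSeries.exists_ker_eq [Group.IsSolvable G] {m n : ℕ} (hG : IsGeneratedBy G m)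
    {S : Fin (n + 1) → Subgroup G} (hS : IsPrincipalSeries S) (i : Fin n) :
    ∃ f : G →* iteratedWreath m i, f.ker = S i.succ := by
  have hstep : ∀ {C : Type} [Group C] [UniqueProds C] (j : Fin n) (φ : G →* C),
      φ.ker = S j.castSucc → ∃ f : G →* restrictedWreath (FreeAb m) C, f.ker = S j.succ := by
    intro C _ _ j φ hφ
    have h1 := hS.normal j.castSucc
    have h2 := hS.normal j.succ
    have hT : HasTorsionFreeFactor (S j.castSucc) (S j.succ) := ⟨h1, h2, hS.factor j⟩
    have hle := (hS.succ_lt j).le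
    rw [← hφ] at hT hle
    exact exists_hom_restrictedWreath_ker_eq φ _ hle hT.2.2 (isFolner_of_isSolvable _) hG
  obtain ⟨i, hi⟩ := i
  induction i with
  | zero =>
    -- the first step embeds into `A_m ≀ 1 = A_m`
    obtain ⟨f, hf⟩ := hstep (C := PUnit) ⟨0, hi⟩ 1
      ((MonoidHom.ker_one).trans hS.zero_eq_top.symm)
    let e := restrictedWreathPUnit (FreeAb m)
    exact ⟨e.toMonoidHom.comp f,
      (MonoidHom.ker_comp_of_injective f e.toMonoidHom e.injective).trans hf⟩
  | succ i ih =>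
    obtain ⟨φ, hφ⟩ := ih (by omega)
    exact hstep ⟨i + 1, hi⟩ φ hφ

theorem IsNRigid.exists_injective_iteratedWreath {m n : ℕ} (hn : IsNRigid G (n + 1))
    (hG : IsGeneratedBy G m) : ∃ f : G →* iteratedWreath m n, Function.Injective f := by
  obtain ⟨⟨k, S, hS⟩, hc, _⟩ := hn
  have hk := hS.length_le hc
  have : Group.IsSolvable G := ⟨⟨n + 1, hc⟩⟩
  cases k with
  | zero =>
    have htop : (⊥ : Subgroup G) = ⊤ := hS.last_eq_bot.symm.trans hS.zero_eq_top
    have := Subgroup.subsingleton_iff.1 (subsingleton_of_bot_eq_top htop)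
    exact ⟨1, Function.injective_of_subsingleton _⟩
  | succ k =>
    obtain ⟨f, hf⟩ := hS.exists_ker_eq hG (Fin.last k)
    rw [Fin.succ_last, hS.last_eq_bot, MonoidHom.ker_eq_bot_iff] at hf
    obtain ⟨g, hg⟩ := exists_injective_iteratedWreath_of_le m (Nat.le_of_succ_le_succ hk)
    exact ⟨g.comp f, hg.comp hf⟩

theorem IsNRigid.subsingleton (h : IsNRigid G 0) : Subsingleton G :=
  Subgroup.subsingleton_iff.1 (subsingleton_of_bot_eq_top h.2.1.symm)

end Embedding

theorem mainTheorem4 :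
    -- every `m`-generated `n`-rigid group embeds into `W(m,n)`
    (∀ (m n : ℕ) (G : Type*) [Group G], IsNRigid G n → IsGeneratedBy G m →
      ∃ f : G →* iteratedWreath m n, Function.Injective f) ∧
    -- an `(n+1)`-rigid one already embeds into `W(m,n)`, which is built from `n + 1` copies of `A_m`
    (∀ (m n : ℕ) (G : Type*) [Group G], IsNRigid G (n + 1) → IsGeneratedBy G m →
      ∃ f : G →* iteratedWreath m n, Function.Injective f) ∧
    (∀ m n : ℕ, IsRigid (iteratedWreath m n)) ∧
    (∀ (m n : ℕ) (H : Subgroup (iteratedWreath m n)), H.FG → IsRigid H) := by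
  refine ⟨fun m n G _ hn hG => ?_, fun m n G _ hn hG => hn.exists_injective_iteratedWreath hG,
    fun m n => isRigid_of_injective_iteratedWreath (MonoidHom.id _) Function.injective_id,
    fun m n H _ => isRigid_of_injective_iteratedWreath H.subtype H.subtype_injective⟩
  cases n with
  | zero =>
    have := hn.subsingleton
    exact ⟨1, Function.injective_of_subsingleton _⟩
  | succ n =>
    obtain ⟨f, hf⟩ := hn.exists_injective_iteratedWreath hG
    obtain ⟨g, hg⟩ := exists_injective_iteratedWreath_succ m n
    exact ⟨g.comp f, hg.comp hf⟩
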